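/- Theorem. Let $q$ be a prime power, $\Lambda=\mathbb F_q[T]$, $F=\mathbb F_q((T^{-1}))$ with $|x|=q^{\deg x}$ for $x\ne 0$ and $|0|=0$, and equip $F^d$ with the norm $\|\mathbf x\|=\max_i|x_i|$. Let $n\ge 1$, $\mathbf a=(\alpha_0,\dots,\alpha_{n-1})\in F^n$, and let $$\mathscr H=\{(\mathbf x,\tilde{\mathbf x}\cdot\mathbf a):\mathbf x\in F^{n-1}\}\subseteq F^n,\qquad \tilde{\mathbf x}=(1,\mathbf x).$$ Suppose there is $\delta>0$ such that for all but finitely many $q'\in\Lambda$, $$\max_{0\le i\le n-1}|p_i+\alpha_i q'|>|q'|^{-(n-\delta)}\quad\text{for all }\mathbf p=(p_0,\dots,p_{n-1})\in\Lambda^n .$$ Let $\psi:\{q^r:r\in\mathbb Z_{\ge0}\}\to\{q^r:r\in\mathbb Z\}$ be nonincreasing, and call $\mathbf y\in\mathscr H$ $\psi$-approximable if for infinitely many nonzero $\mathbf q\in\Lambda^n$ there is $p\in\Lambda$ with $|\mathbf y\cdot\mathbf q+p|<\psi(\|\mathbf q\|)$. Then, in $[0,\infty]$, $$\sum_{\mathbf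 q\in\Lambda^n\setminus\{\mathbf 0\}}\psi(\|\mathbf q\|)=(q^n-1)\sum_{t=0}^\infty\psi(q^t)\,q^{nt},$$ and whenever this sum is finite, the set of $\psi$-approximable points of $\mathscr H$ has measure zero; that is, the set of $\mathbf x\in F^{n-1}$ such that $(\mathbf x,\tilde{\mathbf x}\cdot\mathbf a)$ is $\psi$-approximable is null for the Haar measure on $F^{n-1}$ that gives the closed unit ball measure $1$. -/

import Mathlib

open Filter Topology MeasureTheory Polynomial
open scoped ENNReal LaurentSeries

namespace FunctionFieldApprox

/-! Throughout, `K = 𝔽_q` is a finite field, `Λ = 𝔽_q[T]` is the Mathlib polynomial ring `K[X]`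
(so its variable is `T`), and `F = 𝔽_q((T⁻¹))` is the Mathlib type `K⸨X⸩` of Laurent series
(so its variable is `T⁻¹`), with the topology that Mathlib puts on it, in which the sets
`{y | y - x has no coefficients in degrees below N}` form a basis of neighbourhoods of `x`. -/

variable (K : Type*) [Field K]

/-- The inclusion of `Λ = 𝔽_q[T]` into `F = 𝔽_q((T⁻¹))`. The variable `T` goes to the inverse
of the variable `T⁻¹` of the Laurent series. -/
noncomputable def incl : K[X] →ₐ[K] K⸨X⸩ :=
  Polynomial.aeval (HahnSeries.single (-1 : ℤ) (1 : K))

variable {K}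

open Classical in
/-- The absolute value on `F`: `|0| = 0` and `|x| = q ^ deg x`. The degree in `T` of a nonzero
`x` is minus its order in `T⁻¹`. -/
noncomputable def absF (x : K⸨X⸩) : ℝ :=
  if x = 0 then 0 else (Nat.card K : ℝ) ^ (-x.order)

/-- The supremum norm on `F ^ d`. -/
noncomputable def supNorm {d : ℕ} (x : Fin d → K⸨X⸩) : ℝ := ⨆ i, absF (x i)

/-- The supremum norm of a vector of polynomials. -/
noncomputable def polyNorm {d : ℕ} (v : Fin d → K[X]) : ℝ := supNorm fun i => incl K (v i)

/-! ### The normalised Haar measure on `F ^ d` -/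

theorem absF_le_one_iff [Finite K] (x : K⸨X⸩) :
    absF x ≤ 1 ↔ ∀ i : ℤ, i < 0 → x.coeff i = 0 := by
  have hq : (1 : ℝ) < Nat.card K := by exact_mod_cast Finite.one_lt_card
  by_cases hx : x = 0
  · simp [absF, hx]
  · rw [absF, if_neg hx, zpow_le_one_iff_right₀ hq]
    constructor
    · intro h i hi
      exact HahnSeries.coeff_eq_zero_of_lt_order (by lia)
    · intro h
      by_contra hlt
      exact HahnSeries.coeff_order_eq_zero.not.2 hx (h _ (by lia))

theorem absF_le_one_iff_valued [Finite K] (x : K⸨X⸩) :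
    absF x ≤ 1 ↔ Valued.v x ≤ (1 : WithZero (Multiplicative ℤ)) := by
  have h := LaurentSeries.valuation_le_iff_coeff_lt_eq_zero K (D := 0) (f := x)
  rw [neg_zero, WithZero.exp_zero] at h
  rw [h, absF_le_one_iff]

theorem absF_nonneg (x : K⸨X⸩) : 0 ≤ absF x := by
  unfold absF
  split_ifs <;> positivity

theorem supNorm_le_one_iff {d : ℕ} (x : Fin d → K⸨X⸩) :
    supNorm x ≤ 1 ↔ ∀ i, absF (x i) ≤ 1 := by
  constructor
  · intro h i
    exact (le_ciSup (f := fun i => absF (x i)) (Set.finite_range _).bddAbove i).trans h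
  · intro h
    exact Real.iSup_le h zero_le_one

/-- The topology of `F` in terms of coefficients. -/
theorem mem_nhds_iff_coeff {s : Set K⸨X⸩} {x : K⸨X⸩} :
    s ∈ 𝓝 x ↔ ∃ N : ℤ, {y : K⸨X⸩ | ∀ i : ℤ, i < N → (y - x).coeff i = 0} ⊆ s := by
  rw [Valued.mem_nhds]
  constructor
  · rintro ⟨γ, hγ⟩
    obtain ⟨c, hc⟩ : ∃ c, MonoidWithZeroHom.ValueGroup₀.embedding γ.1 = c := ⟨_, rfl⟩
    have hc0 : c ≠ 0 := by
      rw [← hc]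
      simp
    refine ⟨-WithZero.log c + 1, fun y hy => hγ ?_⟩
    have h1 := (LaurentSeries.valuation_le_iff_coeff_lt_eq_zero K).2 hy
    change Valued.v.restrict (y - x) < γ.1
    rw [Valuation.restrict_lt_iff_lt_embedding, hc]
    refine h1.trans_lt ?_
    rw [← WithZero.lt_log_iff_exp_lt hc0]
    lia
  · rintro ⟨N, hN⟩
    have h0 : Valued.v.restrict (HahnSeries.single N (1 : K) : K⸨X⸩) ≠ 0 := by
      simp
    refine ⟨Units.mk0 _ h0, fun y hy => hN fun i hi => ?_⟩
    have h1 : Valued.v (y - x) < Valued.v (HahnSeries.single N (1 : K) : K⸨X⸩) := by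
      simpa using hy
    rw [LaurentSeries.valuation_single_zpow] at h1
    exact LaurentSeries.coeff_zero_of_lt_valuation K h1.le hi

theorem continuous_powerSeries_mk [TopologicalSpace K] [DiscreteTopology K] :
    Continuous fun g : ℕ → K => HahnSeries.ofPowerSeries ℤ K (PowerSeries.mk g) := by
  rw [continuous_iff_continuousAt]
  intro g s hs
  obtain ⟨N, hN⟩ := mem_nhds_iff_coeff.1 hs
  have hU : {h : ℕ → K | ∀ i ∈ Finset.range N.toNat, h i = g i} ∈ 𝓝 g := by
    have h1 : ∀ i ∈ Finset.range N.toNat, ∀ᶠ h : ℕ → K in 𝓝 g, h i = g i := fun i _ =>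
      (continuous_apply i).continuousAt (mem_nhds_discrete.2 (Set.mem_singleton (g i)))
    exact (Filter.eventually_all_finset _).2 h1
  refine mem_map.2 (mem_of_superset hU fun h hh => hN fun i hi => ?_)
  rw [← map_sub]
  rcases lt_or_ge i 0 with hi0 | hi0
  · rw [PowerSeries.coeff_coe, if_pos hi0]
  · rw [PowerSeries.coeff_coe, if_neg (not_lt.2 hi0), map_sub, PowerSeries.coeff_mk,
      PowerSeries.coeff_mk, sub_eq_zero]
    exact hh _ (Finset.mem_range.2 (by lia))

theorem isCompact_unitBall_one [Finite K] :
    IsCompact {x : K⸨X⸩ | Valued.v x ≤ (1 : WithZero (Multiplicative ℤ))} := by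
  let _ : TopologicalSpace K := ⊥
  have : DiscreteTopology K := ⟨rfl⟩
  have h := isCompact_range (continuous_powerSeries_mk (K := K))
  convert h using 1
  ext x
  refine (LaurentSeries.val_le_one_iff_eq_coe K x).trans ?_
  constructor
  · rintro ⟨f, rfl⟩
    refine ⟨fun i => PowerSeries.coeff i f, ?_⟩
    have : (PowerSeries.mk fun i => PowerSeries.coeff i f) = f := by
      ext
      simp
    simp only [this]
  · rintro ⟨g, rfl⟩
    exact ⟨_, rfl⟩

theorem unitBall_eq_pi [Finite K] (d : ℕ) :
    {x : Fin d → K⸨X⸩ | supNorm x ≤ 1} =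
      Set.univ.pi fun _ => {x : K⸨X⸩ | Valued.v x ≤ (1 : WithZero (Multiplicative ℤ))} := by
  ext x
  simp [supNorm_le_one_iff, absF_le_one_iff_valued]

variable (K) in
/-- The closed unit ball of `F ^ d`, as a compact set with nonempty interior. -/
noncomputable def unitBall [Finite K] (d : ℕ) :
    TopologicalSpace.PositiveCompacts (Fin d → K⸨X⸩) where
  carrier := {x | supNorm x ≤ 1}
  isCompact' := by
    rw [unitBall_eq_pi]
    exact isCompact_univ_pi fun _ => isCompact_unitBall_one
  interior_nonempty' := by
    rw [unitBall_eq_pi]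
    refine ⟨0, mem_interior_iff_mem_nhds.2 (set_pi_mem_nhds Set.finite_univ fun i _ => ?_)⟩
    refine mem_nhds_iff_coeff.2 ⟨0, fun y hy => ?_⟩
    have h := (LaurentSeries.valuation_le_iff_coeff_lt_eq_zero K (D := 0)).2 hy
    simpa using h

variable (K) in
/-- The Haar measure on `F ^ d`, on the Borel sets, that takes the value `1` on the closed
unit ball. -/
noncomputable def haar [Finite K] (d : ℕ) : @Measure (Fin d → K⸨X⸩) (borel _) :=
  letI : MeasurableSpace (Fin d → K⸨X⸩) := borel _
  haveI : BorelSpace (Fin d → K⸨X⸩) := ⟨rfl⟩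
  Measure.addHaarMeasure (unitBall K d)

/-! ### Approximation on hyperplanes -/

variable (K) in
/-- A nonincreasing approximation function `{q ^ r : r ≥ 0} → {q ^ r : r ∈ ℤ}`. It is given by
a function on `ℝ`, whose values outside `{q ^ r : r ≥ 0}` are irrelevant. -/
structure IsApproximationFunction (ψ : ℝ → ℝ) : Prop where
  mapsTo : Set.MapsTo ψ (Set.range fun r : ℕ => (Nat.card K : ℝ) ^ r)
    (Set.range fun r : ℤ => (Nat.card K : ℝ) ^ r)
  antitoneOn : AntitoneOn ψ (Set.range fun r : ℕ => (Nat.card K : ℝ) ^ r)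

/-- The point `(x, α₀ + α₁ x₁ + ⋯ + αₘ xₘ)` of `F ^ (m + 1)`. -/
noncomputable def hyperplanePoint {m : ℕ} (a : Fin (m + 1) → K⸨X⸩) (x : Fin m → K⸨X⸩) :
    Fin (m + 1) → K⸨X⸩ :=
  Fin.snoc x (a 0 + ∑ i : Fin m, a i.succ * x i)

/-- The affine hyperplane `{(x, x̃ · a) : x ∈ F ^ m}` of `F ^ (m + 1)`, where `x̃ = (1, x)`. -/
noncomputable def hyperplane {m : ℕ} (a : Fin (m + 1) → K⸨X⸩) : Set (Fin (m + 1) → K⸨X⸩) :=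
  Set.range (hyperplanePoint a)

/-- `y` is `ψ`-approximable: for infinitely many `v ∈ Λ ^ d` there is `p ∈ Λ` such that
`|y · v + p| < ψ(‖v‖)`. -/
def IsApproximable {d : ℕ} (ψ : ℝ → ℝ) (y : Fin d → K⸨X⸩) : Prop :=
  {v : Fin d → K[X] | v ≠ 0 ∧
    ∃ p : K[X], absF (∑ i, y i * incl K (v i) + incl K p) < ψ (polyNorm v)}.Infinite

/-- The set of `ψ`-approximable points of the hyperplane. -/
def approximablePoints {m : ℕ} (a : Fin (m + 1) → K⸨X⸩) (ψ : ℝ → ℝ) :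
    Set (Fin (m + 1) → K⸨X⸩) :=
  {y ∈ hyperplane a | IsApproximable ψ y}

/-- The measure of a subset of the hyperplane: the Haar measure on `F ^ m`, transported by the
parametrisation `x ↦ (x, x̃ · a)`. -/
noncomputable def hyperplaneMeasure [Finite K] {m : ℕ} (a : Fin (m + 1) → K⸨X⸩)
    (S : Set (Fin (m + 1) → K⸨X⸩)) : ℝ≥0∞ :=
  haar K m (hyperplanePoint a ⁻¹' S)

/-- The Diophantine condition on `a ∈ F ^ n`: for some `δ > 0` and all but finitely many
`q' ∈ Λ`, one has `max_i |p_i + α_i q'| > |q'| ^ (-(n - δ))` for all `p ∈ Λ ^ n`. -/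
def DiophantineCondition {n : ℕ} (a : Fin n → K⸨X⸩) : Prop :=
  ∃ δ : ℝ, 0 < δ ∧ ∀ᶠ q' : K[X] in cofinite, ∀ p : Fin n → K[X],
    absF (incl K q') ^ (-((n : ℝ) - δ)) < supNorm fun i => incl K (p i) + a i * incl K q'

/-- The sum of `ψ(‖v‖)` over the nonzero `v ∈ Λ ^ n`, in `[0, ∞]`. -/
noncomputable def vectorSum (K : Type*) [Field K] (n : ℕ) (ψ : ℝ → ℝ) : ℝ≥0∞ :=
  ∑' v : {v : Fin n → K[X] // v ≠ 0}, ENNReal.ofReal (ψ (polyNorm v.1))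

/-- The sum of `ψ(q ^ t) q ^ (n t)` over `t ≥ 0`, in `[0, ∞]`. -/
noncomputable def radialSum (K : Type*) [Field K] (n : ℕ) (ψ : ℝ → ℝ) : ℝ≥0∞ :=
  ∑' t : ℕ, ENNReal.ofReal (ψ ((Nat.card K : ℝ) ^ t) * (Nat.card K : ℝ) ^ (n * t))

end FunctionFieldApprox

/-! Write `c(v) = (v_i + α_{i+1} v_m)_i`, so that the point of the hyperplane above `x` satisfies
`y · v = c(v) · x + α₀ v_m`. On a unit ball the proof is a Borel–Cantelli argument over `v`.

* If some `|c(v)_j| ≥ q ^ (-s - 1)`, then the points of a unit ball at which `y · v` is within `ε`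
  of `Λ` form a set of measure at most `q ^ s ε` (`haar_nearHyperplanes_le`). This is proved by
  packing disjoint translates of the set into the ball, without integration. For `s = 0` the bound
  is `ψ(‖v‖)`, so the vectors with a coefficient of absolute value at least `q⁻¹` contribute at
  most `vectorSum`.
* For the other vectors `max |c(v)_i| < q⁻¹`. Such a `v` is determined by its last entry, of
  degree `t` say, so small `t` may be disregarded. Convergence gives
  `ψ(q ^ t) ≪ q ^ (-(m + 1) t)`, which is below the bound `q ^ (-κ t)`, `κ = m + 1 - δ`, of the Diophantine condition. If
  the neighbourhood meets the ball, then `max |c(v)_i|` is therefore not zero, say `q ^ (-s - 1)`,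
  and `α₀ v_m` is within a constant times `q ^ (-s)` of `Λ`, and `s < κ t + O(1)`. By the
  Diophantine condition again, applied to differences, the last entries of two such vectors are
  separated at scale `q ^ (s / κ)` up to bounded multiplicity, so there are `O(q ^ (t - s / κ))`
  of them (`HasExponent.injOn_smallVectors`). Weighted by the factor `q ^ s` this is
  `O(q ^ (κ t))` for every `s` (`HasExponent.ncard_mul_le`), and the total measure for given `t` is
  `O(t q ^ (κ t) ψ(q ^ t)) = O(t q ^ (-δ t))`, which is summable.

The exponent estimate uses `κ ≥ 1`. It is available because `δ` may be decreased to at most `1`, and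
because for `m = 0` there are no `c(v)_i`, so that no vector of the second kind with `t` large
matters.

The identity for `vectorSum` counts the `q ^ (n (t + 1)) - q ^ (n t)` vectors of norm `q ^ t`. -/

namespace FunctionFieldApprox

/-! ### The absolute value on `F` -/

variable {K : Type*} [Field K]

theorem one_lt_card_real (K : Type*) [Field K] [Finite K] : (1 : ℝ) < Nat.card K := by
  exact_mod_cast Finite.one_lt_card

theorem card_pos_real (K : Type*) [Field K] [Finite K] : (0 : ℝ) < Nat.card K :=
  zero_lt_one.trans (one_lt_card_real K)

@[simp]
theorem absF_zero : absF (0 : K⸨X⸩) = 0 := by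
  simp [absF]

theorem absF_of_ne_zero {x : K⸨X⸩} (hx : x ≠ 0) : absF x = (Nat.card K : ℝ) ^ (-x.order) := by
  simp [absF, hx]

theorem absF_pos [Finite K] {x : K⸨X⸩} (hx : x ≠ 0) : 0 < absF x := by
  rw [absF_of_ne_zero hx]
  exact zpow_pos (card_pos_real K) _

theorem absF_mul [Finite K] (x y : K⸨X⸩) : absF (x * y) = absF x * absF y := by
  by_cases hx : x = 0
  · simp [hx]
  by_cases hy : y = 0
  · simp [hy]
  rw [absF_of_ne_zero hx, absF_of_ne_zero hy, absF_of_ne_zero (mul_ne_zero hx hy),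
    HahnSeries.order_mul hx hy, neg_add, zpow_add₀ (card_pos_real K).ne']

theorem absF_lt_zpow_iff [Finite K] (x : K⸨X⸩) (k : ℤ) :
    absF x < (Nat.card K : ℝ) ^ k ↔ ∀ i : ℤ, i ≤ -k → x.coeff i = 0 := by
  by_cases hx : x = 0
  · simp [hx, zpow_pos (card_pos_real K)]
  rw [absF_of_ne_zero hx, zpow_lt_zpow_iff_right₀ (one_lt_card_real K)]
  constructor
  · intro h i hi
    exact HahnSeries.coeff_eq_zero_of_lt_order (by lia)
  · intro h
    by_contra hlt
    exact HahnSeries.coeff_order_eq_zero.not.2 hx (h _ (by lia))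

theorem absF_le_zpow_iff [Finite K] (x : K⸨X⸩) (k : ℤ) :
    absF x ≤ (Nat.card K : ℝ) ^ k ↔ ∀ i : ℤ, i < -k → x.coeff i = 0 := by
  by_cases hx : x = 0
  · simp [hx, zpow_nonneg (card_pos_real K).le]
  rw [absF_of_ne_zero hx, zpow_le_zpow_iff_right₀ (one_lt_card_real K)]
  constructor
  · intro h i hi
    exact HahnSeries.coeff_eq_zero_of_lt_order (by lia)
  · intro h
    by_contra hlt
    exact HahnSeries.coeff_order_eq_zero.not.2 hx (h _ (by lia))

theorem absF_add_le [Finite K] (x y : K⸨X⸩) : absF (x + y) ≤ max (absF x) (absF y) := by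
  by_cases hx : x = 0
  · simp [hx]
  by_cases hy : y = 0
  · simp [hy]
  by_cases hxy : x + y = 0
  · simp [hxy, absF_nonneg]
  have h := HahnSeries.min_order_le_order_add hxy
  have hq := one_lt_card_real K
  rw [absF_of_ne_zero hx, absF_of_ne_zero hy, absF_of_ne_zero hxy, le_max_iff,
    zpow_le_zpow_iff_right₀ hq, zpow_le_zpow_iff_right₀ hq]
  rcases min_le_iff.1 h with h | h
  · exact Or.inl (by lia)
  · exact Or.inr (by lia)

@[simp]
theorem absF_neg (x : K⸨X⸩) : absF (-x) = absF x := by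
  by_cases hx : x = 0
  · simp [hx]
  rw [absF_of_ne_zero hx, absF_of_ne_zero (neg_ne_zero.2 hx), HahnSeries.order_neg]

theorem absF_sub_le [Finite K] (x y : K⸨X⸩) : absF (x - y) ≤ max (absF x) (absF y) := by
  simpa [sub_eq_add_neg] using absF_add_le x (-y)

theorem absF_sum_le [Finite K] {ι : Type*} (s : Finset ι) (f : ι → K⸨X⸩) {B : ℝ} (hB : 0 ≤ B)
    (h : ∀ i ∈ s, absF (f i) ≤ B) : absF (∑ i ∈ s, f i) ≤ B := by
  classical
  induction s using Finset.induction_on with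
  | empty => simpa using hB
  | insert i s hi ih =>
    rw [Finset.sum_insert hi]
    exact (absF_add_le _ _).trans (max_le (h _ (Finset.mem_insert_self _ _))
      (ih fun j hj => h j (Finset.mem_insert_of_mem hj)))

theorem absF_le_supNorm {d : ℕ} (x : Fin d → K⸨X⸩) (i : Fin d) : absF (x i) ≤ supNorm x :=
  le_ciSup (f := fun i => absF (x i)) (Set.finite_range _).bddAbove i

theorem supNorm_nonneg {d : ℕ} (x : Fin d → K⸨X⸩) : 0 ≤ supNorm x :=
  Real.iSup_nonneg fun _ => absF_nonneg _

theorem exists_absF_eq_supNorm {d : ℕ} {x : Fin d → K⸨X⸩} (hx : 0 < supNorm x) :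
    ∃ i, absF (x i) = supNorm x := by
  have : Nonempty (Fin d) := by
    by_contra hd
    rw [not_nonempty_iff] at hd
    simp [supNorm] at hx
  exact exists_eq_ciSup_of_finite (f := fun i => absF (x i))

theorem supNorm_add_le_one [Finite K] {d : ℕ} {x y : Fin d → K⸨X⸩} (hx : supNorm x ≤ 1)
    (hy : supNorm y ≤ 1) : supNorm (x + y) ≤ 1 := by
  rw [supNorm_le_one_iff] at *
  exact fun i => (absF_add_le _ _).trans (max_le (hx i) (hy i))

/-- An inner product of two vectors is bounded by the product of their norms. -/
theorem absF_sum_mul_le [Finite K] {d : ℕ} (c x : Fin d → K⸨X⸩) {M R : ℝ} (hM : 0 ≤ M)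
    (hR : 0 ≤ R) (hc : ∀ i, absF (c i) ≤ M) (hx : ∀ i, absF (x i) ≤ R) :
    absF (∑ i, c i * x i) ≤ R * M := by
  refine absF_sum_le _ _ (by positivity) fun i _ => ?_
  rw [absF_mul, mul_comm]
  exact mul_le_mul (hx i) (hc i) (absF_nonneg _) hR

/-! ### Polynomials inside `F` -/

theorem incl_monomial (n : ℕ) (r : K) :
    incl K (Polynomial.monomial n r) = HahnSeries.single (-(n : ℤ)) r := by
  rw [incl, Polynomial.aeval_monomial, HahnSeries.single_pow,
    HahnSeries.algebraMap_apply', PowerSeries.algebraMap_apply, HahnSeries.ofPowerSeries_C,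
    HahnSeries.C_apply, HahnSeries.single_mul_single]
  simp

theorem coeff_incl (p : K[X]) (i : ℤ) :
    (incl K p).coeff i = if i ≤ 0 then p.coeff (-i).toNat else 0 := by
  induction p using Polynomial.induction_on' with
  | add p r hp hr =>
    rw [map_add, HahnSeries.coeff_add, hp, hr]
    split_ifs <;> simp
  | monomial n r =>
    rw [incl_monomial, HahnSeries.coeff_single, Polynomial.coeff_monomial]
    split_ifs <;> first | rfl | lia

theorem absF_incl_lt_iff [Finite K] (p : K[X]) (t : ℕ) :
    absF (incl K p) < (Nat.card K : ℝ) ^ t ↔ p ∈ Polynomial.degreeLT K t := by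
  rw [← zpow_natCast, absF_lt_zpow_iff, Polynomial.mem_degreeLT,
    Polynomial.degree_lt_iff_coeff_zero]
  constructor
  · intro h i hi
    have := h (-i) (by lia)
    rw [coeff_incl, if_pos (by lia)] at this
    simpa using this
  · intro h i hi
    rw [coeff_incl, if_pos (by lia)]
    exact h _ (by lia)

theorem eq_zero_of_absF_incl_lt_one [Finite K] {p : K[X]} (h : absF (incl K p) < 1) : p = 0 := by
  have := (absF_incl_lt_iff p 0).1 (by simpa using h)
  simpa [Polynomial.mem_degreeLT] using this

theorem absF_incl [Finite K] {p : K[X]} (hp : p ≠ 0) :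
    absF (incl K p) = (Nat.card K : ℝ) ^ p.natDegree := by
  have h1 : absF (incl K p) ≤ (Nat.card K : ℝ) ^ p.natDegree := by
    rw [← zpow_natCast, absF_le_zpow_iff]
    intro i hi
    rw [coeff_incl, if_pos (by lia)]
    exact Polynomial.coeff_eq_zero_of_natDegree_lt (by lia)
  refine h1.antisymm (not_lt.1 fun h => ?_)
  rw [absF_incl_lt_iff, Polynomial.mem_degreeLT, Polynomial.degree_eq_natDegree hp] at h
  exact lt_irrefl _ h

/-- Every element of `F` is a polynomial plus an element of the closed unit ball. -/
theorem exists_absF_sub_incl_le_one [Finite K] (x : K⸨X⸩) :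
    ∃ p : K[X], absF (x - incl K p) ≤ 1 := by
  refine ⟨∑ k ∈ Finset.range ((-x.order).toNat + 1), Polynomial.monomial k (x.coeff (-k)), ?_⟩
  rw [absF_le_one_iff]
  intro i hi
  rw [HahnSeries.coeff_sub, coeff_incl, if_pos hi.le, Polynomial.finsetSum_coeff]
  simp only [Polynomial.coeff_monomial]
  rw [Finset.sum_ite_eq' (Finset.range _) (-i).toNat, sub_eq_zero]
  split_ifs with h
  · congr 1
    lia
  · rw [Finset.mem_range] at h
    exact HahnSeries.coeff_eq_zero_of_lt_order (by lia)

theorem polyNorm_lt_iff [Finite K] {d : ℕ} (v : Fin d → K[X]) (t : ℕ) :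
    polyNorm v < (Nat.card K : ℝ) ^ t ↔ ∀ i, v i ∈ Polynomial.degreeLT K t := by
  simp only [← absF_incl_lt_iff]
  constructor
  · exact fun h i => (absF_le_supNorm (fun i => incl K (v i)) i).trans_lt h
  · intro h
    rcases (supNorm_nonneg fun i => incl K (v i)).eq_or_lt with h0 | h0
    · rw [polyNorm, ← h0]
      exact pow_pos (card_pos_real K) _
    · obtain ⟨i, hi⟩ := exists_absF_eq_supNorm h0
      rw [polyNorm, ← hi]
      exact h i

theorem exists_polyNorm_eq [Finite K] {d : ℕ} {v : Fin d → K[X]} (hv : v ≠ 0) :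
    ∃ t : ℕ, polyNorm v = (Nat.card K : ℝ) ^ t := by
  obtain ⟨i, hi⟩ := Function.ne_iff.1 hv
  have h0 : 0 < supNorm fun i => incl K (v i) := by
    refine lt_of_lt_of_le ?_ (absF_le_supNorm _ i)
    rw [absF_incl hi]
    exact pow_pos (card_pos_real K) _
  obtain ⟨j, hj⟩ := exists_absF_eq_supNorm h0
  refine ⟨(v j).natDegree, ?_⟩
  rw [polyNorm, ← hj, absF_incl]
  intro hj0
  rw [← hj, hj0] at h0
  simp at h0

/-! ### The measure of a neighbourhood of a family of parallel hyperplanes -/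

/-- The Laurent polynomial `∑_{s < i ≤ s + N} w_i T⁻ⁱ`, with the digits indexed from `0`. -/
noncomputable def digits (s N : ℕ) (w : Fin N → K) : K⸨X⸩ :=
  ∑ i : Fin N, HahnSeries.single ((s : ℤ) + 1 + (i : ℕ)) (w i)

theorem coeff_digits (s N : ℕ) (w : Fin N → K) (k : ℤ) :
    (digits s N w).coeff k = ∑ i : Fin N, if k = (s : ℤ) + 1 + (i : ℕ) then w i else 0 := by
  rw [digits, HahnSeries.coeff_sum]
  refine Finset.sum_congr rfl fun i _ => ?_
  rw [HahnSeries.coeff_single]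
  congr

theorem coeff_digits_self (s N : ℕ) (w : Fin N → K) (i : Fin N) :
    (digits s N w).coeff ((s : ℤ) + 1 + (i : ℕ)) = w i := by
  rw [coeff_digits, Finset.sum_eq_single i]
  · simp
  · intro j _ hj
    rw [if_neg]
    intro h
    exact hj (Fin.ext (by lia))
  · simp

theorem absF_digits_le [Finite K] (s N : ℕ) (w : Fin N → K) :
    absF (digits s N w) ≤ (Nat.card K : ℝ) ^ (-(s : ℤ) - 1) := by
  rw [absF_le_zpow_iff]
  intro k hk
  rw [coeff_digits]
  exact Finset.sum_eq_zero fun i _ => if_neg (by lia)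

/-- The digit sums are separated modulo `Λ`: two of them do not differ by a polynomial up to an
error smaller than the weight of the last digit. -/
theorem eq_of_digits_sub_eq [Finite K] {s N : ℕ} {w w' : Fin N → K} {p : K[X]} {y : K⸨X⸩}
    (hy : absF y < (Nat.card K : ℝ) ^ (-((s : ℤ) + N)))
    (h : digits s N w - digits s N w' = incl K p + y) : w = w' := by
  ext i
  have hi := congrArg (fun z : K⸨X⸩ => z.coeff ((s : ℤ) + 1 + (i : ℕ))) h
  simp only [HahnSeries.coeff_sub, HahnSeries.coeff_add, coeff_digits_self] at hi
  have hi' : (s : ℤ) + 1 + (i : ℕ) ≤ -(-((s : ℤ) + N)) := by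
    have := i.2
    omega
  rw [coeff_incl, if_neg (by lia), (absF_lt_zpow_iff y _).1 hy _ hi', add_zero,
    sub_eq_zero] at hi
  exact hi

theorem isOpen_absF_lt [Finite K] (k : ℤ) :
    IsOpen {x : K⸨X⸩ | absF x < (Nat.card K : ℝ) ^ k} := by
  rw [isOpen_iff_mem_nhds]
  intro x hx
  refine mem_nhds_iff_coeff.2 ⟨-k + 1, fun y hy => ?_⟩
  have h : absF (y - x) < (Nat.card K : ℝ) ^ k :=
    (absF_lt_zpow_iff _ _).2 fun i hi => hy i (by lia)
  have h2 := absF_add_le (y - x) x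
  rw [sub_add_cancel] at h2
  exact h2.trans_lt (max_lt h hx)

theorem isOpen_unitBall [Finite K] (d : ℕ) : IsOpen {x : Fin d → K⸨X⸩ | supNorm x ≤ 1} := by
  have h1 : {x : K⸨X⸩ | absF x ≤ 1} = {x : K⸨X⸩ | absF x < (Nat.card K : ℝ) ^ (1 : ℤ)} := by
    ext x
    rw [Set.mem_ofPred_eq, Set.mem_ofPred_eq, absF_lt_zpow_iff, absF_le_one_iff]
    exact forall_congr' fun i => by rw [show i < 0 ↔ i ≤ -1 by lia]
  have h : {x : Fin d → K⸨X⸩ | supNorm x ≤ 1} =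
      Set.univ.pi fun _ => {x : K⸨X⸩ | absF x ≤ 1} := by
    ext x
    simp [supNorm_le_one_iff]
  rw [h, h1]
  exact isOpen_set_pi Set.finite_univ fun _ _ => isOpen_absF_lt 1

/-- The points of the unit ball around `x₀` at which the affine function `x ↦ c · x + b` is within
`q ^ (-e)` of `Λ`. -/
def nearHyperplanes {d : ℕ} (x₀ c : Fin d → K⸨X⸩) (b : K⸨X⸩) (e : ℤ) : Set (Fin d → K⸨X⸩) :=
  {x | supNorm (x - x₀) ≤ 1 ∧
    ∃ p : K[X], absF (∑ i, c i * x i + b + incl K p) < (Nat.card K : ℝ) ^ (-e)}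

theorem isOpen_nearHyperplanes [Finite K] {d : ℕ} (x₀ c : Fin d → K⸨X⸩) (b : K⸨X⸩) (e : ℤ) :
    IsOpen (nearHyperplanes x₀ c b e) := by
  have h : nearHyperplanes x₀ c b e = {x | supNorm (x - x₀) ≤ 1} ∩
      ⋃ p : K[X], {x | absF (∑ i, c i * x i + b + incl K p) < (Nat.card K : ℝ) ^ (-e)} := by
    ext x
    simp [nearHyperplanes]
  rw [h]
  refine ((isOpen_unitBall d).preimage (continuous_id.sub continuous_const)).inter ?_
  refine isOpen_iUnion fun p => (isOpen_absF_lt (-e)).preimage ?_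
  fun_prop

/-- If some `|c_j|` is at least `q ^ (-s - 1)` then the neighbourhood of radius `q ^ (-e)` has
measure at most `q ^ (s - e)`: its translates by `h / c_j` in the `j`-th coordinate, where `h`
runs over the `q ^ (e - s)` digit sums with digits in the places `s + 1, …, e`, are disjoint subsets of one unit
ball. -/
theorem haar_nearHyperplanes_le [Finite K] {d : ℕ} (x₀ c : Fin d → K⸨X⸩) (b : K⸨X⸩) (e : ℤ) (s : ℕ)
    (j : Fin d) (hj : (Nat.card K : ℝ) ^ (-(s : ℤ) - 1) ≤ absF (c j)) :
    haar K d (nearHyperplanes x₀ c b e) ≤ ENNReal.ofReal ((Nat.card K : ℝ) ^ ((s : ℤ) - e)) := by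
  let _ : MeasurableSpace (Fin d → K⸨X⸩) := borel _
  have : BorelSpace (Fin d → K⸨X⸩) := ⟨rfl⟩
  have hq := one_lt_card_real K
  set μ : Measure (Fin d → K⸨X⸩) := Measure.addHaarMeasure (unitBall K d) with hμ
  change μ _ ≤ _
  have hball : μ {x | supNorm (x - x₀) ≤ 1} = 1 := by
    have h1 : μ {x | supNorm x ≤ 1} = 1 := Measure.addHaarMeasure_self
    rw [← h1, ← measure_preimage_add_right μ (-x₀) {x | supNorm x ≤ 1}]
    simp [sub_eq_add_neg]
  rcases lt_or_ge e s with hes | hes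
  · calc μ _ ≤ μ {x | supNorm (x - x₀) ≤ 1} := measure_mono fun x hx => hx.1
      _ = ENNReal.ofReal 1 := by rw [hball, ENNReal.ofReal_one]
      _ ≤ _ := ENNReal.ofReal_le_ofReal (one_le_zpow₀ hq.le (by lia))
  obtain ⟨N, rfl⟩ : ∃ N : ℕ, e = s + N := ⟨(e - s).toNat, by lia⟩
  have hcj : c j ≠ 0 := by
    intro h
    rw [h, absF_zero] at hj
    exact (zpow_pos (card_pos_real K) _).not_ge hj
  set S := nearHyperplanes x₀ c b (s + N) with hS
  let g : (Fin N → K) → Fin d → K⸨X⸩ := fun w => Pi.single j (digits s N w / c j)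
  have hg : ∀ w, supNorm (g w) ≤ 1 := by
    intro w
    rw [supNorm_le_one_iff]
    intro i
    by_cases hi : i = j
    · subst hi
      have h1 : absF (digits s N w / c i) * absF (c i) ≤ 1 * absF (c i) := by
        rw [← absF_mul, div_mul_cancel₀ _ hcj, one_mul]
        exact (absF_digits_le s N w).trans hj
      simpa [g] using le_of_mul_le_mul_right h1 (absF_pos hcj)
    · simp [g, hi]
  have hsum : ∀ w, ∑ i, c i * g w i = digits s N w := by
    intro w
    rw [Finset.sum_eq_single j]
    · simp [g, mul_div_cancel₀ _ hcj]
    · intro i _ hi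
      simp [g, hi]
    · simp
  have hmeas : ∀ w, MeasurableSet ((fun x => x + -g w) ⁻¹' S) := fun w =>
    ((isOpen_nearHyperplanes x₀ c b _).preimage
      (continuous_id.add continuous_const)).measurableSet
  have hdisj : Pairwise (Function.onFun Disjoint fun w => (fun x => x + -g w) ⁻¹' S) := by
    intro w w' hne
    refine Set.disjoint_left.2 fun x hx hx' => hne ?_
    obtain ⟨-, p, hp⟩ := hx
    obtain ⟨-, p', hp'⟩ := hx'
    have h2 : ∀ w, ∑ i, c i * (x + -g w) i = ∑ i, c i * x i - digits s N w := by
      intro w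
      rw [← hsum w, ← Finset.sum_sub_distrib]
      exact Finset.sum_congr rfl fun i _ => by simp; ring
    rw [h2] at hp hp'
    refine eq_of_digits_sub_eq (p := p - p')
      ((absF_sub_le _ _).trans_lt (max_lt hp' hp)) ?_
    rw [map_sub]
    ring
  have hunion : (⋃ w, (fun x => x + -g w) ⁻¹' S) ⊆ {x | supNorm (x - x₀) ≤ 1} := by
    refine Set.iUnion_subset fun w x hx => ?_
    have := supNorm_add_le_one hx.1 (hg w)
    rwa [show x + -g w - x₀ + g w = x - x₀ by abel] at this
  have hle := measure_mono (μ := μ) hunion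
  rw [measure_iUnion hdisj hmeas, hball] at hle
  simp only [measure_preimage_add_right] at hle
  have : Fintype K := Fintype.ofFinite K
  rw [tsum_fintype, Finset.sum_const, Finset.card_univ, Fintype.card_fun, Fintype.card_fin,
    nsmul_eq_mul, ← Nat.card_eq_fintype_card] at hle
  have hN : ENNReal.ofReal ((Nat.card K : ℝ) ^ ((s : ℤ) - (s + N))) =
      ((Nat.card K ^ N : ℕ) : ℝ≥0∞)⁻¹ := by
    rw [show (s : ℤ) - (s + N) = -(N : ℤ) by ring, zpow_neg, zpow_natCast,
      ENNReal.ofReal_inv_of_pos (by positivity), ← Nat.cast_pow, ENNReal.ofReal_natCast]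
  rw [hN, ENNReal.le_inv_iff_mul_le, mul_comm]
  exact hle

/-! ### The sum over integer vectors -/

theorem finite_degreeLT [Finite K] (t : ℕ) : Finite (Polynomial.degreeLT K t) :=
  Finite.of_equiv _ (Polynomial.degreeLTEquiv K t).symm.toEquiv

theorem encard_polyNorm_lt [Finite K] (n t : ℕ) :
    {v : Fin n → K[X] | polyNorm v < (Nat.card K : ℝ) ^ t}.encard =
      ((Nat.card K ^ t) ^ n : ℕ) := by
  have := finite_degreeLT (K := K) t
  let E : {v : Fin n → K[X] | polyNorm v < (Nat.card K : ℝ) ^ t} ≃ (Fin n → Fin t → K) :=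
    ((Equiv.subtypeEquivRight fun v => polyNorm_lt_iff v t).trans
      Equiv.subtypePiEquivPi).trans
      (Equiv.piCongrRight fun _ => (Polynomial.degreeLTEquiv K t).toEquiv)
  rw [Set.encard, ENat.card_congr E, ENat.card_eq_coe_natCard]
  simp [Nat.card_fun]

theorem encard_polyNorm_eq [Finite K] (n t : ℕ) :
    {v : Fin n → K[X] | v ≠ 0 ∧ polyNorm v = (Nat.card K : ℝ) ^ t}.encard =
      ((Nat.card K ^ n - 1) * Nat.card K ^ (n * t) : ℕ) := by
  have hq := one_lt_card_real K
  have hsub : {v : Fin n → K[X] | polyNorm v < (Nat.card K : ℝ) ^ t} ⊆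
      {v : Fin n → K[X] | polyNorm v < (Nat.card K : ℝ) ^ (t + 1)} := fun v hv =>
    hv.trans (pow_lt_pow_right₀ hq (Nat.lt_succ_self t))
  have h : {v : Fin n → K[X] | v ≠ 0 ∧ polyNorm v = (Nat.card K : ℝ) ^ t} =
      {v : Fin n → K[X] | polyNorm v < (Nat.card K : ℝ) ^ (t + 1)} \
        {v : Fin n → K[X] | polyNorm v < (Nat.card K : ℝ) ^ t} := by
    ext v
    simp only [Set.mem_ofPred_eq, Set.mem_sdiff]
    constructor
    · rintro ⟨-, h⟩
      rw [h]
      exact ⟨pow_lt_pow_right₀ hq (Nat.lt_succ_self t), lt_irrefl _⟩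
    · rintro ⟨h1, h2⟩
      have hv : v ≠ 0 := by
        rintro rfl
        refine h2 ((polyNorm_lt_iff _ _).2 fun i => ?_)
        exact zero_mem _
      obtain ⟨k, hk⟩ := exists_polyNorm_eq hv
      rw [hk, pow_lt_pow_iff_right₀ hq] at h1 h2
      exact ⟨hv, by rw [hk, show k = t by lia]⟩
  rw [h]
  have h3 := Set.encard_sdiff_add_encard_of_subset hsub
  rw [encard_polyNorm_lt, encard_polyNorm_lt] at h3
  have h4 : (Nat.card K ^ (t + 1)) ^ n =
      (Nat.card K ^ n - 1) * Nat.card K ^ (n * t) + (Nat.card K ^ t) ^ n := by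
    have h5 : 1 ≤ Nat.card K ^ n := Nat.one_le_pow _ _ Nat.card_pos
    obtain ⟨r, hr⟩ := Nat.exists_eq_add_of_le h5
    rw [pow_succ, mul_pow, hr, Nat.add_sub_cancel_left, ← pow_mul, mul_comm t n]
    ring
  rw [h4, Nat.cast_add] at h3
  exact WithTop.add_right_cancel (ENat.natCast_ne_top _) h3

theorem vectorSum_eq [Finite K] (n : ℕ) (ψ : ℝ → ℝ)
    (hψ : ∀ t : ℕ, 0 ≤ ψ ((Nat.card K : ℝ) ^ t)) :
    vectorSum K n ψ = ((Nat.card K : ℝ≥0∞) ^ n - 1) * radialSum K n ψ := by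
  have hq := one_lt_card_real K
  choose D hD using fun v : {v : Fin n → K[X] // v ≠ 0} => exists_polyNorm_eq v.2
  rw [vectorSum, ← ENNReal.tsum_fiberwise _ D, radialSum, ← ENNReal.tsum_mul_left]
  refine tsum_congr fun t => ?_
  have h1 : ∀ v : D ⁻¹' {t}, ENNReal.ofReal (ψ (polyNorm v.1.1)) =
      ENNReal.ofReal (ψ ((Nat.card K : ℝ) ^ t)) := by
    rintro ⟨v, hv⟩
    rw [hD v, show D v = t from hv]
  rw [tsum_congr h1, ENNReal.tsum_const]
  have h2 : ENat.card (D ⁻¹' {t}) = ((Nat.card K ^ n - 1) * Nat.card K ^ (n * t) : ℕ) := by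
    rw [← encard_polyNorm_eq (K := K) n t]
    change (D ⁻¹' {t}).encard = _
    rw [← Subtype.val_injective.encard_image]
    congr 1
    ext v
    constructor
    · rintro ⟨w, hw, rfl⟩
      exact ⟨w.2, by rw [hD w, show D w = t from hw]⟩
    · rintro ⟨hv, h⟩
      refine ⟨⟨v, hv⟩, ?_, rfl⟩
      rw [hD ⟨v, hv⟩] at h
      exact pow_right_injective₀ (card_pos_real K) hq.ne' h
  rw [h2, ENNReal.ofReal_mul (hψ t)]
  have h3 : ENNReal.ofReal ((Nat.card K : ℝ) ^ (n * t)) = (Nat.card K : ℝ≥0∞) ^ (n * t) := by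
    rw [ENNReal.ofReal_pow (Nat.cast_nonneg _), ENNReal.ofReal_natCast]
  rw [h3, ENat.toENNReal_coe]
  push_cast
  ring

/-! ### Integer vectors whose linear form has small coefficients -/

/-- The coefficients `v_i + α_{i+1} v_m` of the affine function `x ↦ (x, x̃ · a) · v`. -/
noncomputable def linearCoeff {m : ℕ} (a : Fin (m + 1) → K⸨X⸩) (v : Fin (m + 1) → K[X]) :
    Fin m → K⸨X⸩ :=
  fun i => incl K (v i.castSucc) + a i.succ * incl K (v (Fin.last m))

theorem linearCoeff_sub {m : ℕ} (a : Fin (m + 1) → K⸨X⸩) (v w : Fin (m + 1) → K[X]) (i : Fin m) :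
    linearCoeff a (v - w) i = linearCoeff a v i - linearCoeff a w i := by
  simp only [linearCoeff, Pi.sub_apply, map_sub]
  ring

theorem sum_hyperplanePoint_mul {m : ℕ} (a : Fin (m + 1) → K⸨X⸩) (x : Fin m → K⸨X⸩)
    (v : Fin (m + 1) → K[X]) :
    ∑ i, hyperplanePoint a x i * incl K (v i) =
      ∑ i, linearCoeff a v i * x i + a 0 * incl K (v (Fin.last m)) := by
  rw [Fin.sum_univ_castSucc]
  simp only [hyperplanePoint, Fin.snoc_castSucc, Fin.snoc_last, linearCoeff]
  rw [add_mul, Finset.sum_mul, add_comm (a 0 * _), ← add_assoc, ← Finset.sum_add_distrib]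
  congr 1
  exact Finset.sum_congr rfl fun i _ => by ring

/-- If the linear coefficients are all less than `1` then the last entry determines the vector. -/
theorem eq_of_last_eq [Finite K] {m : ℕ} {a : Fin (m + 1) → K⸨X⸩} {v w : Fin (m + 1) → K[X]}
    (hv : ∀ i, absF (linearCoeff a v i) < 1) (hw : ∀ i, absF (linearCoeff a w i) < 1)
    (h : v (Fin.last m) = w (Fin.last m)) : v = w := by
  ext1 i
  refine Fin.lastCases h (fun i => ?_) i
  rw [← sub_eq_zero]
  refine eq_zero_of_absF_incl_lt_one ?_
  have h1 : incl K (v i.castSucc - w i.castSucc) = linearCoeff a v i - linearCoeff a w i := by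
    simp only [linearCoeff, map_sub, h]
    ring
  rw [h1]
  exact (absF_sub_le _ _).trans_lt (max_lt (hv i) (hw i))

/-- `κ` is a Diophantine exponent for `a`, valid for denominators of degree at least `t₀`. The
denominator is the last entry of `v`, and the numerators are `p` and the other entries of `v`. The
bound on the maximum is expressed through an arbitrary upper bound `B`. -/
def HasExponent {m : ℕ} (a : Fin (m + 1) → K⸨X⸩) (κ : ℝ) (t₀ : ℕ) : Prop :=
  ∀ (v : Fin (m + 1) → K[X]) (p : K[X]) (B : ℝ), t₀ ≤ (v (Fin.last m)).natDegree →
    absF (incl K p + a 0 * incl K (v (Fin.last m))) ≤ B → (∀ i, absF (linearCoeff a v i) ≤ B) →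
    (Nat.card K : ℝ) ^ (-κ * (v (Fin.last m)).natDegree) < B

/-- The parameter `δ` may be decreased, so the exponent `κ = m + 1 - δ` may be taken to be at
least `m`. -/
theorem DiophantineCondition.exists_hasExponent [Finite K] {m : ℕ} {a : Fin (m + 1) → K⸨X⸩}
    (ha : DiophantineCondition a) :
    ∃ κ : ℝ, m ≤ κ ∧ κ < m + 1 ∧ ∃ t₀ : ℕ, HasExponent a κ t₀ := by
  obtain ⟨δ, hδ, h⟩ := ha
  refine ⟨m + 1 - min δ 1, by linarith [min_le_right δ 1],
    by linarith [lt_min hδ one_pos], ?_⟩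
  obtain ⟨b, hb⟩ := ((Filter.eventually_cofinite.1 h).image Polynomial.natDegree).bddAbove
  refine ⟨b + 1, fun v p B hv h0 hc => ?_⟩
  have hgood : ∀ p : Fin (m + 1) → K[X], absF (incl K (v (Fin.last m))) ^
      (-(((m + 1 : ℕ) : ℝ) - δ)) <
        supNorm fun i => incl K (p i) + a i * incl K (v (Fin.last m)) := by
    by_contra hbad
    have := hb ⟨_, hbad, rfl⟩
    lia
  have hne : v (Fin.last m) ≠ 0 := by
    intro h
    simp [h] at hv
  have h1 := hgood (Fin.cons p fun i => v i.castSucc)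
  rw [absF_incl hne, ← Real.rpow_natCast, ← Real.rpow_mul (card_pos_real K).le] at h1
  refine lt_of_le_of_lt (Real.rpow_le_rpow_of_exponent_le (one_lt_card_real K).le ?_)
    (h1.trans_le (ciSup_le fun i => Fin.cases ?_ (fun j => ?_) i))
  · push_cast
    have := mul_le_mul_of_nonneg_left (min_le_left δ 1)
      (Nat.cast_nonneg (α := ℝ) (v (Fin.last m)).natDegree)
    nlinarith
  · simpa using h0
  · simpa [linearCoeff] using hc j

/-- The vectors `v` with last entry of degree `t` (or zero, if `t = 0`) and
`max |v_i + α_{i+1} v_m| = q ^ (-s - 1)` for which `α₀ v_m` has distance at most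
`q ^ (r - s - 1)` from `Λ`. -/
def smallVectors {m : ℕ} (a : Fin (m + 1) → K⸨X⸩) (r t s : ℕ) : Set (Fin (m + 1) → K[X]) :=
  {v | (v (Fin.last m)).natDegree = t ∧
    (∀ i, absF (linearCoeff a v i) ≤ (Nat.card K : ℝ) ^ (-(s : ℤ) - 1)) ∧
    (∃ j, absF (linearCoeff a v j) = (Nat.card K : ℝ) ^ (-(s : ℤ) - 1)) ∧
    ∃ p : K[X], absF (incl K p + a 0 * incl K (v (Fin.last m))) ≤
      (Nat.card K : ℝ) ^ ((r : ℤ) - s - 1)}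

theorem zpow_sub_one_lt_one [Finite K] (s : ℕ) : (Nat.card K : ℝ) ^ (-(s : ℤ) - 1) < 1 :=
  zpow_lt_one_of_neg₀ (one_lt_card_real K) (by lia)

theorem HasExponent.lt_of_mem_smallVectors [Finite K] {m : ℕ} {a : Fin (m + 1) → K⸨X⸩} {κ : ℝ}
    {t₀ : ℕ} (h : HasExponent a κ t₀) {r t s : ℕ} (ht : t₀ ≤ t) {v : Fin (m + 1) → K[X]}
    (hv : v ∈ smallVectors a r t s) : (s : ℝ) + 1 < κ * t + r := by
  have hq := one_lt_card_real K
  obtain ⟨rfl, hc, -, p, hp⟩ := hv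
  have h1 := h v p _ ht hp fun i => (hc i).trans (zpow_le_zpow_right₀ hq.le (by lia))
  rw [← Real.rpow_intCast, Real.rpow_lt_rpow_left_iff hq] at h1
  push_cast at h1
  linarith

/-- By the Diophantine condition two elements of `smallVectors a r t s` cannot differ by a vector
whose last entry has degree in `[t₀, u)`, so an element is determined by the coefficients of its
last entry below `t₀` and from `u` on. -/
theorem HasExponent.injOn_smallVectors [Finite K] {m : ℕ} {a : Fin (m + 1) → K⸨X⸩} {κ : ℝ} {t₀ : ℕ}
    (h : HasExponent a κ t₀) (hκ : 0 ≤ κ) (r t s u : ℕ) (hu : u = 0 ∨ κ * u + r ≤ s + 1) :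
    Set.InjOn (fun v : Fin (m + 1) → K[X] =>
      ((fun i => (v (Fin.last m)).coeff i : Fin t₀ → K),
        (fun i => (v (Fin.last m)).coeff (u + i) : Fin (t + 1 - u) → K)))
      (smallVectors a r t s) := by
  have hq := one_lt_card_real K
  rintro v ⟨hvt, hv, -, p, hp⟩ w ⟨hwt, hw, -, p', hp'⟩ hvw
  obtain ⟨hlow, hhigh⟩ := Prod.mk.inj hvw
  refine eq_of_last_eq (a := a) (fun i => (hv i).trans_lt (zpow_sub_one_lt_one s))
    (fun i => (hw i).trans_lt (zpow_sub_one_lt_one s)) ?_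
  by_contra hne
  set z := (v - w) (Fin.last m) with hz
  have hz0 : z ≠ 0 := sub_ne_zero.2 hne
  have hzlead : z.coeff z.natDegree ≠ 0 := Polynomial.leadingCoeff_ne_zero.2 hz0
  have hcoeff : ∀ i, z.coeff i = (v (Fin.last m)).coeff i - (w (Fin.last m)).coeff i := fun i =>
    Polynomial.coeff_sub _ _ _
  have h1 : t₀ ≤ z.natDegree := by
    by_contra hlt
    refine hzlead ?_
    rw [hcoeff, sub_eq_zero]
    exact congrFun hlow ⟨z.natDegree, not_le.1 hlt⟩
  have h2 : z.natDegree < u := by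
    by_contra hlt
    refine hzlead ?_
    rw [hcoeff, sub_eq_zero]
    rcases lt_or_ge t z.natDegree with h3 | h3
    · rw [Polynomial.coeff_eq_zero_of_natDegree_lt (by lia),
        Polynomial.coeff_eq_zero_of_natDegree_lt (by lia)]
    · have := congrFun hhigh ⟨z.natDegree - u, by lia⟩
      simpa [show u + (z.natDegree - u) = z.natDegree by lia] using this
  have h4 := h (v - w) (p - p') ((Nat.card K : ℝ) ^ ((r : ℤ) - s - 1)) h1 ?_ fun i => ?_
  · rw [← Real.rpow_intCast, Real.rpow_lt_rpow_left_iff hq, ← hz] at h4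
    push_cast at h4
    rcases hu with hu | hu
    · lia
    · have h5 : (z.natDegree : ℝ) ≤ u := by exact_mod_cast h2.le
      have := mul_le_mul_of_nonneg_left h5 hκ
      linarith
  · have h5 : incl K (p - p') + a 0 * incl K ((v - w) (Fin.last m)) =
        (incl K p + a 0 * incl K (v (Fin.last m))) -
          (incl K p' + a 0 * incl K (w (Fin.last m))) := by
      simp only [Pi.sub_apply, map_sub]
      ring
    rw [h5]
    exact (absF_sub_le _ _).trans (max_le hp hp')
  · rw [linearCoeff_sub]
    exact ((absF_sub_le _ _).trans (max_le (hv i) (hw i))).trans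
      (zpow_le_zpow_right₀ hq.le (by lia))

theorem HasExponent.finite_smallVectors [Finite K] {m : ℕ} {a : Fin (m + 1) → K⸨X⸩} {κ : ℝ} {t₀ : ℕ}
    (h : HasExponent a κ t₀) (hκ : 0 ≤ κ) (r t s : ℕ) : (smallVectors a r t s).Finite :=
  Set.Finite.of_injOn (Set.mapsTo_univ _ _) (h.injOn_smallVectors hκ r t s 0 (Or.inl rfl))
    Set.finite_univ

theorem HasExponent.ncard_smallVectors_le [Finite K] {m : ℕ} {a : Fin (m + 1) → K⸨X⸩} {κ : ℝ}
    {t₀ : ℕ} (h : HasExponent a κ t₀) (hκ : 0 ≤ κ) (r t s u : ℕ) (hu : u = 0 ∨ κ * u + r ≤ s + 1) :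
    (smallVectors a r t s).ncard ≤ Nat.card K ^ (t₀ + (t + 1 - u)) := by
  refine (Set.ncard_le_ncard_of_injOn _ (fun _ _ => Set.mem_univ _)
    (h.injOn_smallVectors hκ r t s u hu) Set.finite_univ).trans ?_
  rw [Set.ncard_univ, Nat.card_prod, Nat.card_fun, Nat.card_fun, Nat.card_fin, Nat.card_fin,
    pow_add]

/-- With the degree `u` about `(s - r) / κ`, the count of small vectors, weighted by `q ^ s`, is at
most a constant times `q ^ (κ t)`. -/
theorem HasExponent.ncard_mul_le [Finite K] {m : ℕ} {a : Fin (m + 1) → K⸨X⸩} {κ : ℝ}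
    {t₀ : ℕ} (h : HasExponent a κ t₀) (hκ : m ≤ κ) (r s : ℕ) {t : ℕ} (ht : t₀ ≤ t) :
    ((smallVectors a r t s).ncard : ℝ) * (Nat.card K : ℝ) ^ s ≤
      (Nat.card K : ℝ) ^ (κ * t + (t₀ + κ + r)) := by
  have hq := one_lt_card_real K
  rcases (smallVectors a r t s).eq_empty_or_nonempty with h0 | ⟨v, hv⟩
  · rw [h0]
    simpa using Real.rpow_nonneg (card_pos_real K).le _
  have hst := h.lt_of_mem_smallVectors ht hv
  -- There is a coefficient of exact size `q ^ (-s - 1)`, so `m` is positive.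
  have hm : (1 : ℝ) ≤ m := by
    obtain ⟨-, -, ⟨j, -⟩, -⟩ := hv
    exact_mod_cast Nat.one_le_of_lt j.2
  have hκ1 : 1 ≤ κ := hm.trans hκ
  set u := ⌊((s : ℝ) + 1 - r) / κ⌋₊ with hu
  have hu1 : u = 0 ∨ κ * u + r ≤ s + 1 := by
    rcases Nat.eq_zero_or_pos u with h1 | h1
    · exact Or.inl h1
    · right
      have h2 := (Nat.le_floor_iff' h1.ne').1 (le_of_eq hu)
      rw [le_div_iff₀ (by linarith)] at h2
      linarith
  have hu2 : (s : ℝ) + 1 - r < (u + 1) * κ := by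
    rw [← div_lt_iff₀ (by linarith)]
    exact Nat.lt_floor_add_one _
  have hut : (u : ℝ) ≤ t := by
    rcases hu1 with h1 | h1
    · simp [h1]
    · have : κ * u ≤ κ * t := by linarith
      exact le_of_mul_le_mul_left this (by linarith)
  have hut' : u ≤ t := by exact_mod_cast hut
  have hcard := h.ncard_smallVectors_le (by linarith) r t s u hu1
  calc ((smallVectors a r t s).ncard : ℝ) * (Nat.card K : ℝ) ^ s
      ≤ (Nat.card K : ℝ) ^ (t₀ + (t + 1 - u)) * (Nat.card K : ℝ) ^ s := by
        gcongr
        exact_mod_cast hcard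
    _ = (Nat.card K : ℝ) ^ ((t₀ : ℝ) + (t + 1 - u) + s) := by
        rw [← pow_add, ← Real.rpow_natCast]
        push_cast [Nat.cast_sub (show u ≤ t + 1 by lia)]
        rfl
    _ ≤ _ := by
        refine Real.rpow_le_rpow_of_exponent_le hq.le ?_
        nlinarith [mul_le_mul_of_nonneg_left hut (sub_nonneg.2 hκ1)]

/-! ### The Borel–Cantelli argument -/

/-- The points of the unit ball around `x₀` that lie within `q ^ (-e)` of one of the hyperplanes of
some `v` with last entry of degree `t` and small linear coefficients. -/
def nearSmallVectors {m : ℕ} (a : Fin (m + 1) → K⸨X⸩) (x₀ : Fin m → K⸨X⸩) (r t : ℕ) (e : ℤ) :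
    Set (Fin m → K⸨X⸩) :=
  ⋃ s : ℕ, ⋃ v ∈ smallVectors a r t s,
    nearHyperplanes x₀ (linearCoeff a v) (a 0 * incl K (v (Fin.last m))) e

theorem HasExponent.haar_nearSmallVectors_le [Finite K] {m : ℕ} {a : Fin (m + 1) → K⸨X⸩} {κ : ℝ}
    {t₀ : ℕ} (h : HasExponent a κ t₀) (hκ : m ≤ κ) (x₀ : Fin m → K⸨X⸩) (r : ℕ) {t : ℕ} (ht : t₀ ≤ t)
    (e : ℤ) :
    haar K m (nearSmallVectors a x₀ r t e) ≤ ENNReal.ofReal ((κ * t + r + 1) *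
      ((Nat.card K : ℝ) ^ (κ * t + (t₀ + κ + r)) * (Nat.card K : ℝ) ^ (-e))) := by
  have hq0 := card_pos_real K
  have hκ0 : 0 ≤ κ := (Nat.cast_nonneg m).trans hκ
  have hS0 : 0 ≤ κ * t + r := by positivity
  have hfin := h.finite_smallVectors hκ0 r t
  set S := ⌈κ * t + r⌉₊
  set D : ℝ := (Nat.card K : ℝ) ^ (κ * t + (t₀ + κ + r)) * (Nat.card K : ℝ) ^ (-e) with hD
  have hD0 : 0 ≤ D := by positivity
  have hsub : nearSmallVectors a x₀ r t e ⊆ ⋃ s ∈ Finset.range S, ⋃ v ∈ (hfin s).toFinset,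
      nearHyperplanes x₀ (linearCoeff a v) (a 0 * incl K (v (Fin.last m))) e := by
    intro x hx
    simp only [nearSmallVectors, Set.mem_iUnion] at hx
    obtain ⟨s, v, hv, hx⟩ := hx
    have h1 := h.lt_of_mem_smallVectors ht hv
    simp only [Set.mem_iUnion]
    exact ⟨s, Finset.mem_range.2 (Nat.lt_ceil.2 (by linarith)), v, (hfin s).mem_toFinset.2 hv, hx⟩
  have hone : ∀ s, haar K m (⋃ v ∈ (hfin s).toFinset,
      nearHyperplanes x₀ (linearCoeff a v) (a 0 * incl K (v (Fin.last m))) e) ≤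
        ENNReal.ofReal D := by
    intro s
    refine (measure_biUnion_finset_le _ _).trans ?_
    refine (Finset.sum_le_card_nsmul _ _ (ENNReal.ofReal ((Nat.card K : ℝ) ^ ((s : ℤ) - e)))
      fun v hv => ?_).trans ?_
    · obtain ⟨-, -, ⟨j, hj⟩, -⟩ := (hfin s).mem_toFinset.1 hv
      exact haar_nearHyperplanes_le _ _ _ _ _ j hj.ge
    · rw [nsmul_eq_mul, ← ENNReal.ofReal_natCast, ← ENNReal.ofReal_mul (Nat.cast_nonneg _),
        ← Set.ncard_eq_toFinset_card _ (hfin s)]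
      refine ENNReal.ofReal_le_ofReal ?_
      rw [sub_eq_add_neg, zpow_add₀ hq0.ne', zpow_natCast, ← mul_assoc]
      exact mul_le_mul_of_nonneg_right (h.ncard_mul_le hκ r s ht) (zpow_nonneg hq0.le _)
  refine (measure_mono hsub).trans ((measure_biUnion_finset_le _ _).trans ?_)
  refine (Finset.sum_le_card_nsmul _ _ _ fun s _ => hone s).trans ?_
  rw [nsmul_eq_mul, ← ENNReal.ofReal_natCast, ← ENNReal.ofReal_mul (Nat.cast_nonneg _),
    Finset.card_range]
  exact ENNReal.ofReal_le_ofReal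
    (mul_le_mul_of_nonneg_right (Nat.ceil_lt_add_one hS0).le hD0)

/-- When `q ^ (-e t) ≪ q ^ (-(m + 1) t)` the sets `nearSmallVectors a x₀ r t (e t)` have measure
`O(t q ^ (-δ t))` with `δ = m + 1 - κ`. -/
theorem HasExponent.tsum_haar_nearSmallVectors_ne_top [Finite K] {m : ℕ} {a : Fin (m + 1) → K⸨X⸩}
    {κ : ℝ} {t₀ : ℕ} (h : HasExponent a κ t₀) (hκ : m ≤ κ) (hκ' : κ < m + 1)
    (x₀ : Fin m → K⸨X⸩) (r : ℕ) (e : ℕ → ℤ) (C : ℝ)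
    (he : ∀ t, (Nat.card K : ℝ) ^ (-e t) ≤ C * (Nat.card K : ℝ) ^ (-((m + 1 : ℝ) * t))) :
    ∑' t : ℕ, haar K m (nearSmallVectors a x₀ r (t + t₀) (e (t + t₀))) ≠ ⊤ := by
  have hq := one_lt_card_real K
  have hq0 := card_pos_real K
  have hκ0 : 0 ≤ κ := (Nat.cast_nonneg m).trans hκ
  set ρ : ℝ := (Nat.card K : ℝ) ^ (κ - (m + 1)) with hρ
  have hρ0 : 0 ≤ ρ := Real.rpow_nonneg hq0.le _
  have hρ1 : ‖ρ‖ < 1 := by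
    rw [Real.norm_of_nonneg hρ0]
    exact Real.rpow_lt_one_of_one_lt_of_neg hq (by linarith)
  set A : ℝ := (Nat.card K : ℝ) ^ (t₀ + κ + r) with hA
  have hsum : Summable fun t : ℕ => (κ * t + r + 1) * (A * C * ρ ^ t) := by
    have h1 := (summable_pow_mul_geometric_of_norm_lt_one 1 hρ1).mul_left (κ * A * C)
    have h2 := (summable_pow_mul_geometric_of_norm_lt_one 0 hρ1).mul_left ((r + 1) * A * C)
    refine (h1.add h2).congr fun t => ?_
    simp only [pow_one, pow_zero]
    ring
  refine ne_top_of_le_ne_top ((summable_nat_add_iff t₀).2 hsum).tsum_ofReal_ne_top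
    (ENNReal.tsum_le_tsum fun t => ?_)
  refine (h.haar_nearSmallVectors_le hκ x₀ r (Nat.le_add_left _ _) _).trans
    (ENNReal.ofReal_le_ofReal ?_)
  refine mul_le_mul_of_nonneg_left ?_ (by positivity)
  calc _ ≤ (Nat.card K : ℝ) ^ (κ * (t + t₀ : ℕ) + (t₀ + κ + r)) *
        (C * (Nat.card K : ℝ) ^ (-((m + 1 : ℝ) * (t + t₀ : ℕ)))) := by
        exact mul_le_mul_of_nonneg_left (he _) (by positivity)
    _ = A * C * ρ ^ (t + t₀) := by
        have h1 : (Nat.card K : ℝ) ^ (κ * (t + t₀ : ℕ)) *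
            (Nat.card K : ℝ) ^ (-((m + 1 : ℝ) * (t + t₀ : ℕ))) = ρ ^ (t + t₀) := by
          rw [hρ, ← Real.rpow_natCast, ← Real.rpow_mul hq0.le, ← Real.rpow_add hq0]
          congr 1
          ring
        rw [← h1, Real.rpow_add hq0, ← hA]
        ring

theorem countable_polynomial (K : Type*) [Field K] [Finite K] : Countable K[X] :=
  (Polynomial.basisMonomials K).repr.toEquiv.countable_iff.2 inferInstance

/-- Inside one unit ball almost every point of the hyperplane fails to be approximable. -/
theorem ae_not_isApproximable [Finite K] {m : ℕ} {a : Fin (m + 1) → K⸨X⸩}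
    (ha : DiophantineCondition a) {ψ : ℝ → ℝ} (hψ : IsApproximationFunction K ψ)
    (hv : vectorSum K (m + 1) ψ ≠ ⊤) (hr : radialSum K (m + 1) ψ ≠ ⊤) (x₀ : Fin m → K⸨X⸩) :
    ∀ᵐ x ∂(haar K m), supNorm (x - x₀) ≤ 1 → ¬ IsApproximable ψ (hyperplanePoint a x) := by
  have hq := one_lt_card_real K
  have hq0 := card_pos_real K
  obtain ⟨κ, hκ, hκ', t₀, h⟩ := ha.exists_hasExponent
  have hE : ∀ t : ℕ, ∃ e : ℤ, (Nat.card K : ℝ) ^ (-e) = ψ ((Nat.card K : ℝ) ^ t) := by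
    intro t
    obtain ⟨k, hk⟩ := hψ.mapsTo ⟨t, rfl⟩
    exact ⟨-k, by simpa using hk⟩
  choose e he using hE
  -- The terms of the convergent sum are bounded.
  set C := (radialSum K (m + 1) ψ).toReal with hC
  have hψC : ∀ t : ℕ, (Nat.card K : ℝ) ^ (-e t) ≤ C * (Nat.card K : ℝ) ^ (-((m + 1 : ℝ) * t)) := by
    intro t
    have h1 := (ENNReal.ofReal_le_iff_le_toReal hr).1 (ENNReal.le_tsum (f := fun t : ℕ =>
      ENNReal.ofReal (ψ ((Nat.card K : ℝ) ^ t) * (Nat.card K : ℝ) ^ ((m + 1) * t))) t)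
    have h2 : (Nat.card K : ℝ) ^ ((m + 1 : ℝ) * t) = (Nat.card K : ℝ) ^ ((m + 1) * t) := by
      rw [← Real.rpow_natCast]
      push_cast
      rfl
    rw [Real.rpow_neg hq0.le, h2, ← div_eq_mul_inv, le_div_iff₀ (by positivity), he]
    exact h1
  -- From `t₁` on the approximation function is below the Diophantine bound.
  obtain ⟨t₁, ht₁⟩ : ∃ t₁ : ℕ, ∀ t, t₁ ≤ t →
      (Nat.card K : ℝ) ^ (-e t) ≤ (Nat.card K : ℝ) ^ (-κ * t) := by
    have hlim := (tendsto_pow_atTop_nhds_zero_of_lt_one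
      (Real.rpow_nonneg hq0.le (κ - (m + 1)))
      (Real.rpow_lt_one_of_one_lt_of_neg hq (by linarith : κ - (m + 1) < 0))).const_mul C
    rw [mul_zero] at hlim
    obtain ⟨t₁, ht₁⟩ := eventually_atTop.1 (hlim.eventually (gt_mem_nhds one_pos))
    refine ⟨t₁, fun t ht => (hψC t).trans ?_⟩
    have h1 := ht₁ t ht
    rw [← Real.rpow_natCast, ← Real.rpow_mul hq0.le] at h1
    have h2 : (Nat.card K : ℝ) ^ (-((m + 1 : ℝ) * t)) =
        (Nat.card K : ℝ) ^ ((κ - (m + 1)) * t) * (Nat.card K : ℝ) ^ (-κ * t) := by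
      rw [← Real.rpow_add hq0]
      congr 1
      ring
    rw [h2, ← mul_assoc]
    exact mul_le_of_le_one_left (by positivity) h1.le
  -- A bound `q ^ r` for the norm of the points of the ball.
  obtain ⟨r, hr⟩ : ∃ r : ℕ, supNorm x₀ ≤ (Nat.card K : ℝ) ^ r :=
    (pow_unbounded_of_one_lt _ hq).imp fun _ => le_of_lt
  have hxr : ∀ x : Fin m → K⸨X⸩, supNorm (x - x₀) ≤ 1 → ∀ i, absF (x i) ≤ (Nat.card K : ℝ) ^ r := by
    intro x hx i
    have h1 := absF_add_le ((x - x₀) i) (x₀ i)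
    rw [Pi.sub_apply, sub_add_cancel] at h1
    exact h1.trans (max_le (((absF_le_supNorm (x - x₀) i).trans hx).trans (one_le_pow₀ hq.le))
      ((absF_le_supNorm x₀ i).trans hr))
  choose D hD using fun v : {v : Fin (m + 1) → K[X] // v ≠ 0} => exists_polyNorm_eq v.2
  -- The vectors with a coefficient of absolute value at least `q ^ (-1)`.
  let big : {v : Fin (m + 1) → K[X] // v ≠ 0} → Set (Fin m → K⸨X⸩) := fun v =>
    {x | (∃ j, (Nat.card K : ℝ) ^ (-((0 : ℕ) : ℤ) - 1) ≤ absF (linearCoeff a v.1 j)) ∧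
      x ∈ nearHyperplanes x₀ (linearCoeff a v.1) (a 0 * incl K (v.1 (Fin.last m))) (e (D v))}
  have hbig : ∑' v, haar K m (big v) ≠ ⊤ := by
    refine ne_top_of_le_ne_top hv (ENNReal.tsum_le_tsum fun v => ?_)
    by_cases hj : ∃ j, (Nat.card K : ℝ) ^ (-((0 : ℕ) : ℤ) - 1) ≤ absF (linearCoeff a v.1 j)
    · obtain ⟨j, hj⟩ := hj
      rw [hD v, ← he]
      refine (measure_mono fun x hx => hx.2).trans
        ((haar_nearHyperplanes_le _ _ _ _ 0 j hj).trans (le_of_eq ?_))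
      simp
    · have : big v = ∅ := Set.eq_empty_of_forall_notMem fun x hx => hj hx.1
      rw [this, measure_empty]
      exact zero_le
  have := countable_polynomial K
  have hsmall := h.tsum_haar_nearSmallVectors_ne_top hκ hκ' x₀ r e C hψC
  filter_upwards [ae_finite_setOfPred_mem hbig, ae_finite_setOfPred_mem hsmall]
    with x hx1 hx2 hxx happ
  refine happ ?_
  have hlow : {v : Fin (m + 1) → K[X] | (∀ i, absF (linearCoeff a v i) < 1) ∧
      v (Fin.last m) ∈ Polynomial.degreeLT K (t₀ + t₁)}.Finite := by
    have := finite_degreeLT (K := K) (t₀ + t₁)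
    exact Set.Finite.of_injOn (f := fun v => v (Fin.last m))
      (t := (Polynomial.degreeLT K (t₀ + t₁) : Set K[X])) (fun v hv => hv.2)
      (fun v hv w hw => eq_of_last_eq hv.1 hw.1) (Set.toFinite _)
  have hhigh : (⋃ t ∈ {t : ℕ | x ∈ nearSmallVectors a x₀ r (t + t₀) (e (t + t₀))},
      {v : Fin (m + 1) → K[X] | (∀ i, absF (linearCoeff a v i) < 1) ∧
        v (Fin.last m) ∈ Polynomial.degreeLT K (t + t₀ + 1)}).Finite := by
    refine hx2.biUnion fun t _ => ?_
    have := finite_degreeLT (K := K) (t + t₀ + 1)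
    exact Set.Finite.of_injOn (f := fun v => v (Fin.last m))
      (t := (Polynomial.degreeLT K (t + t₀ + 1) : Set K[X])) (fun v hv => hv.2)
      (fun v hv w hw => eq_of_last_eq hv.1 hw.1) (Set.toFinite _)
  refine (((hx1.image Subtype.val).union hlow).union hhigh).subset ?_
  rintro v ⟨hv0, p, hp⟩
  rw [sum_hyperplanePoint_mul, hD ⟨v, hv0⟩, ← he] at hp
  by_cases hj : ∃ j, (Nat.card K : ℝ) ^ (-((0 : ℕ) : ℤ) - 1) ≤ absF (linearCoeff a v j)
  · exact Or.inl (Or.inl ⟨⟨v, hv0⟩, ⟨hj, hxx, p, hp⟩, rfl⟩)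
  have hlt : ∀ i, absF (linearCoeff a v i) < (Nat.card K : ℝ) ^ (-((0 : ℕ) : ℤ) - 1) := fun i =>
    not_le.1 fun hi => hj ⟨i, hi⟩
  have hlt1 : ∀ i, absF (linearCoeff a v i) < 1 := fun i =>
    (hlt i).trans (zpow_sub_one_lt_one 0)
  by_cases hdeg : v (Fin.last m) ∈ Polynomial.degreeLT K (t₀ + t₁)
  · exact Or.inl (Or.inr ⟨hlt1, hdeg⟩)
  refine Or.inr ?_
  have hne : v (Fin.last m) ≠ 0 := fun h0 => hdeg (h0 ▸ zero_mem _)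
  set t := (v (Fin.last m)).natDegree with ht
  have htt : t₀ + t₁ ≤ t := by
    by_contra hcon
    refine hdeg (Polynomial.mem_degreeLT.2 ?_)
    rw [Polynomial.degree_eq_natDegree hne]
    exact_mod_cast not_le.1 hcon
  -- The norm of `v` is at least `q ^ t`, and `ψ` is nonincreasing.
  have hψt : (Nat.card K : ℝ) ^ (-e (D ⟨v, hv0⟩)) ≤ (Nat.card K : ℝ) ^ (-e t) := by
    rw [he, he]
    refine hψ.antitoneOn ⟨t, rfl⟩ ⟨D ⟨v, hv0⟩, rfl⟩ ?_
    change (Nat.card K : ℝ) ^ t ≤ (Nat.card K : ℝ) ^ D ⟨v, hv0⟩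
    rw [← hD ⟨v, hv0⟩, ht, ← absF_incl hne]
    exact absF_le_supNorm (fun i => incl K (v i)) (Fin.last m)
  have hp' := hp.trans_le hψt
  set M := supNorm (linearCoeff a v) with hM
  have hM0 : 0 ≤ M := supNorm_nonneg _
  have hcM : ∀ i, absF (linearCoeff a v i) ≤ M := absF_le_supNorm _
  have hconst : absF (incl K p + a 0 * incl K (v (Fin.last m))) ≤
      max ((Nat.card K : ℝ) ^ (-e t)) ((Nat.card K : ℝ) ^ r * M) := by
    have h1 : incl K p + a 0 * incl K (v (Fin.last m)) =
        (∑ i, linearCoeff a v i * x i + a 0 * incl K (v (Fin.last m)) + incl K p) -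
          ∑ i, linearCoeff a v i * x i := by ring
    rw [h1]
    exact (absF_sub_le _ _).trans (max_le_max hp'.le
      (absF_sum_mul_le _ _ hM0 (by positivity) hcM (hxr x hxx)))
  have hMle : M ≤ (Nat.card K : ℝ) ^ r * M := le_mul_of_one_le_left hM0 (one_le_pow₀ hq.le)
  -- The maximum cannot be its first member, by the choice of `t₁`.
  have hexp := h v p _ (by lia) hconst fun i => (hcM i).trans (hMle.trans (le_max_right _ _))
  have hψM : (Nat.card K : ℝ) ^ (-e t) < (Nat.card K : ℝ) ^ r * M := by
    rcases lt_max_iff.1 hexp with h1 | h1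
    · exact absurd (ht₁ t (by lia)) h1.not_ge
    · exact (ht₁ t (by lia)).trans_lt h1
  rw [max_eq_right hψM.le] at hconst
  have hMpos : 0 < M := by
    by_contra hcon
    rw [le_antisymm (not_lt.1 hcon) hM0, mul_zero] at hψM
    exact (zpow_pos hq0 _).not_gt hψM
  obtain ⟨j, hjM⟩ := exists_absF_eq_supNorm hMpos
  rw [← hM] at hjM
  obtain ⟨s, hs⟩ : ∃ s : ℕ, M = (Nat.card K : ℝ) ^ (-(s : ℤ) - 1) := by
    have hj0 : linearCoeff a v j ≠ 0 := by
      intro h0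
      rw [h0, absF_zero] at hjM
      exact hMpos.ne hjM
    have h1 := hlt j
    rw [absF_of_ne_zero hj0, zpow_lt_zpow_iff_right₀ hq] at h1
    refine ⟨((linearCoeff a v j).order - 1).toNat, ?_⟩
    rw [← hjM, absF_of_ne_zero hj0]
    congr 1
    lia
  have hmem : v ∈ smallVectors a r t s := by
    refine ⟨rfl, fun i => (hcM i).trans hs.le, ⟨j, hjM.trans hs⟩, p, hconst.trans (le_of_eq ?_)⟩
    rw [hs, ← zpow_natCast, ← zpow_add₀ hq0.ne']
    congr 1
    ring
  have htsub : t - t₀ + t₀ = t := by lia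
  simp only [Set.mem_iUnion]
  refine ⟨t - t₀, ?_, hlt1, ?_⟩
  · change x ∈ nearSmallVectors a x₀ r (t - t₀ + t₀) (e (t - t₀ + t₀))
    rw [htsub]
    simp only [nearSmallVectors, Set.mem_iUnion]
    exact ⟨s, v, hmem, hxx, p, hp'⟩
  · rw [htsub, Polynomial.mem_degreeLT, Polynomial.degree_eq_natDegree hne, ← ht]
    exact_mod_cast Nat.lt_succ_self t

theorem hyperplaneMeasure_approximablePoints_eq_zero [Finite K] {m : ℕ} {a : Fin (m + 1) → K⸨X⸩}
    (ha : DiophantineCondition a) {ψ : ℝ → ℝ} (hψ : IsApproximationFunction K ψ)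
    (hv : vectorSum K (m + 1) ψ ≠ ⊤) (hr : radialSum K (m + 1) ψ ≠ ⊤) :
    hyperplaneMeasure a (approximablePoints a ψ) = 0 := by
  have := countable_polynomial K
  have h1 : ∀ᵐ x ∂(haar K m), ∀ z : Fin m → K[X], supNorm (x - fun i => incl K (z i)) ≤ 1 →
      ¬ IsApproximable ψ (hyperplanePoint a x) :=
    ae_all_iff.2 fun z => ae_not_isApproximable ha hψ hv hr _
  refine measure_mono_null (fun x hx => ?_) (ae_iff.1 h1)
  intro hall
  choose z hz using fun i => exists_absF_sub_incl_le_one (x i)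
  exact hall z ((supNorm_le_one_iff _).2 hz) hx.2

end FunctionFieldApprox

theorem theorem1p1 (K : Type*) [Field K] [Finite K] (m : ℕ) (a : Fin (m + 1) → K⸨X⸩)
    (ha : FunctionFieldApprox.DiophantineCondition a)
    (ψ : ℝ → ℝ) (hψ : FunctionFieldApprox.IsApproximationFunction K ψ) :
    FunctionFieldApprox.vectorSum K (m + 1) ψ =
        ((Nat.card K : ℝ≥0∞) ^ (m + 1) - 1) * FunctionFieldApprox.radialSum K (m + 1) ψ ∧
      (FunctionFieldApprox.vectorSum K (m + 1) ψ < ⊤ →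
        FunctionFieldApprox.hyperplaneMeasure a
          (FunctionFieldApprox.approximablePoints a ψ) = 0) := by
  have heq := FunctionFieldApprox.vectorSum_eq (K := K) (m + 1) ψ fun t => by
    obtain ⟨k, hk⟩ := hψ.mapsTo ⟨t, rfl⟩
    rw [← hk]
    positivity
  refine ⟨heq, fun hlt => ?_⟩
  refine FunctionFieldApprox.hyperplaneMeasure_approximablePoints_eq_zero ha hψ hlt.ne
    fun htop => ?_
  -- The factor `q ^ (m + 1) - 1` does not vanish.
  have hpos : (Nat.card K : ℝ≥0∞) ^ (m + 1) - 1 ≠ 0 := by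
    rw [ne_eq, tsub_eq_zero_iff_le, not_le]
    exact one_lt_pow₀ (by exact_mod_cast Finite.one_lt_card) (Nat.succ_ne_zero m)
  rw [heq, htop, ENNReal.mul_top hpos] at hlt
  exact lt_irrefl _ hlt
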